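/- Let $(M,g)$ be a smooth Lorentzian manifold of dimension $n\ge 2$ and signature $(-,+,\dots,+)$, with Levi-Civita connection $\nabla$, and let $Z$ be a smooth, nontrivial vector field on $M$ which is covariantly constant and null, that is, $\nabla Z=0$ and $g(Z,Z)=0$. Let $\varphi=(u,v,x^1,\dots,x^{n-2})$ be a smooth local coordinate chart with domain $U\subseteq M$ which is adapted to $Z$, that is, $$Z|_U=\partial_v=\operatorname{grad} u ,$$ where $\operatorname{grad}u$ is the vector field with $g(\operatorname{grad} u,\cdot)=du$. Write $g_{\sigma\rho}=g(\partial_\sigma,\partial_\rho)$ for the metric components in this chart, where $\sigma,\rho$ run over all coordinates $u,v,x^1,\dots,x^{n-2}$, and let $a,b\in\{1,\dots,n-2\}$ refer to the coordinates $x^1,\dots,x^{n-2}$ only. Then the following hold on $U$. 1. All metric components are independent of $v$, in the sense that $\partial_v(g_{\sigma\rho})=0$ for all $\sigma,\rho$. 2. $g_{v\sigma}=\delta^u_\sigma$ for all $\sigma$, that is, $g_{vu}=1$, $g_{vv}=0$ and $g_{va}=0$ for all $a$. 3. The matrix $(g_{ab})_{1\le a,b\le n-2}$ is positive definite at every point of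 $U$; and for all constants $c,d\in\mathbb R$ the set $\{p\in U : u(p)=c,\ v(p)=d\}$ is a smooth embedded submanifold of $M$ of codimension $2$ on which $g$ induces a smooth Riemannian metric. -/

import Mathlib

open Bundle
open scoped Manifold ContDiff

noncomputable section

/-- A smooth Lorentzian metric of signature `(-, +, …, +)` on a manifold `M`. -/
structure LorentzianMetric {E : Type*} [NormedAddCommGroup E] [NormedSpace ℝ E]
    {H : Type*} [TopologicalSpace H] (I : ModelWithCorners ℝ E H)
    (M : Type*) [TopologicalSpace M] [ChartedSpace H M] [IsManifold I ∞ M] where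
  val (x : M) : TangentSpace I x →L[ℝ] TangentSpace I x →L[ℝ] ℝ
  symm (x : M) (v w : TangentSpace I x) : val x v w = val x w v
  /-- Every tangent space has a basis that is orthonormal for the metric, with exactly one
  vector of square `-1`. -/
  signature (x : M) : ∃ (k : ℕ) (b : Module.Basis (Fin (k + 1)) ℝ (TangentSpace I x)),
    ∀ i j, val x (b i) (b j) = if i = j then (if i = 0 then -1 else 1) else 0
  contMDiff : ContMDiff I (I.prod 𝓘(ℝ, E →L[ℝ] E →L[ℝ] ℝ)) ∞
    (fun x ↦ TotalSpace.mk' (E →L[ℝ] E →L[ℝ] ℝ)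
      (E := fun x : M ↦ TangentSpace I x →L[ℝ] TangentSpace I x →L[ℝ] ℝ) x (val x))

namespace LorentzianMetric

variable {E : Type*} [NormedAddCommGroup E] [NormedSpace ℝ E]
  {H : Type*} [TopologicalSpace H] {I : ModelWithCorners ℝ E H}
  {M : Type*} [TopologicalSpace M] [ChartedSpace H M] [IsManifold I ∞ M]
  (g : LorentzianMetric I M)

/-- The bilinear form of the metric on a single tangent space. -/
def bilin (x : M) : LinearMap.BilinForm ℝ (TangentSpace I x) :=
  LinearMap.mk₂ ℝ (fun v w ↦ g.val x v w) (by simp) (by simp) (by simp) (by simp)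

@[simp]
lemma bilin_apply (x : M) (v w : TangentSpace I x) : g.bilin x v w = g.val x v w := rfl

lemma eq_zero_of_forall (x : M) (v : TangentSpace I x) (h : ∀ w, g.val x v w = 0) : v = 0 := by
  obtain ⟨k, b, hb⟩ := g.signature x
  apply b.ext_elem
  intro i
  have h1 := h (b i)
  rw [← b.sum_repr v] at h1
  simp only [map_sum, sum_apply, map_smul, smul_apply, hb, smul_eq_mul] at h1
  simp only [mul_ite, mul_zero, Finset.sum_ite_eq', Finset.mem_univ, if_true] at h1
  split_ifs at h1 <;> simpa using h1

lemma bilin_nondegenerate (x : M) : (g.bilin x).Nondegenerate := by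
  refine ⟨fun v h ↦ g.eq_zero_of_forall x v h, fun v h ↦ g.eq_zero_of_forall x v fun w ↦ ?_⟩
  rw [g.symm]; exact h w

lemma mdiffAt_val {x : M} {X Y : Π x : M, TangentSpace I x}
    (hX : MDiffAt (T% X) x) (hY : MDiffAt (T% Y) x) :
    MDiffAt (fun y ↦ g.val y (X y) (Y y)) x := by
  have : MDifferentiableAt I (I.prod 𝓘(ℝ))
      (fun m ↦ TotalSpace.mk' ℝ (E := Bundle.Trivial M ℝ) m (g.val m (X m) (Y m))) x := by
    apply MDifferentiableAt.clm_bundle_apply₂ (F₁ := E) (F₂ := E)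
    · exact g.contMDiff.mdifferentiableAt (by simp)
    · exact hX
    · exact hY
  simp only [mdifferentiableAt_totalSpace] at this
  exact this.2

lemma ext_of_val {x : M} {A B : TangentSpace I x →L[ℝ] TangentSpace I x}
    (h : ∀ X Y : Π x : M, TangentSpace I x, MDiffAt (T% X) x → MDiffAt (T% Y) x →
      g.val x (A (X x)) (Y x) = g.val x (B (X x)) (Y x)) : A = B := by
  ext v
  rw [← sub_eq_zero]
  refine g.eq_zero_of_forall x _ fun w ↦ ?_
  have := h (FiberBundle.extend E v) (FiberBundle.extend E w)
    (FiberBundle.mdifferentiableAt_extend ..) (FiberBundle.mdifferentiableAt_extend ..)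
  simpa [sub_eq_zero] using this

variable [FiniteDimensional ℝ E]

/-- The musical isomorphism `♯`, characterized by `g (♯ α) w = α w` for every `w`. -/
def sharp (x : M) : (TangentSpace I x →L[ℝ] ℝ) →L[ℝ] TangentSpace I x :=
  haveI : FiniteDimensional ℝ (TangentSpace I x) := inferInstanceAs (FiniteDimensional ℝ E)
  LinearMap.toContinuousLinearMap
    { toFun := fun α ↦ ((g.bilin x).toDual (g.bilin_nondegenerate x)).symm α.toLinearMap
      map_add' := fun α β ↦ by simp
      map_smul' := fun c α ↦ by simp }

lemma val_sharp (x : M) (α : TangentSpace I x →L[ℝ] ℝ) (w : TangentSpace I x) :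
    g.val x (g.sharp x α) w = α w :=
  haveI : FiniteDimensional ℝ (TangentSpace I x) := inferInstanceAs (FiniteDimensional ℝ E)
  LinearMap.BilinForm.apply_toDual_symm_apply (B := g.bilin x) (hB := g.bilin_nondegenerate x)
    α.toLinearMap w

/-- The gradient of a real function: `g (grad f) w = df w`. -/
def grad (f : M → ℝ) (x : M) : TangentSpace I x := g.sharp x (d% f x)

open VectorField

/-- The right-hand side of the Koszul formula for `2 g(∇_X σ, Y)`. -/
def koszul (σ X Y : Π x : M, TangentSpace I x) (x : M) : ℝ :=
  d% (fun y ↦ g.val y (σ y) (Y y)) x (X x) + d% (fun y ↦ g.val y (X y) (Y y)) x (σ x)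
    - d% (fun y ↦ g.val y (X y) (σ y)) x (Y x)
    + g.val x (mlieBracket I X σ x) (Y x) - g.val x (mlieBracket I X Y x) (σ x)
    - g.val x (mlieBracket I σ Y x) (X x)

variable {g} in
lemma koszul_tensorial₁ {x : M} {σ Y : Π x : M, TangentSpace I x}
    (hσ : MDiffAt (T% σ) x) (hY : MDiffAt (T% Y) x) :
    TensorialAt I E (fun X ↦ g.koszul σ X Y x) x where
  smul {f X} hf hX := by
    have e1 : (fun y ↦ g.val y ((f • X) y) (Y y)) = f * fun y ↦ g.val y (X y) (Y y) := by
      ext y; simp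
    have e2 : (fun y ↦ g.val y ((f • X) y) (σ y)) = f * fun y ↦ g.val y (X y) (σ y) := by
      ext y; simp
    simp only [koszul, e1, e2, mvfderiv_mul hf (g.mdiffAt_val hX hY),
      mvfderiv_mul hf (g.mdiffAt_val hX hσ), mlieBracket_smul_left hf hX]
    simp
    rw [g.symm x (X x) (Y x), g.symm x (X x) (σ x)]
    ring
  add {X X'} hX hX' := by
    have e1 : (fun y ↦ g.val y ((X + X') y) (Y y)) = (fun y ↦ g.val y (X y) (Y y)) +
        fun y ↦ g.val y (X' y) (Y y) := by
      ext y; simp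
    have e2 : (fun y ↦ g.val y ((X + X') y) (σ y)) = (fun y ↦ g.val y (X y) (σ y)) +
        fun y ↦ g.val y (X' y) (σ y) := by
      ext y; simp
    simp only [koszul, e1, e2, mvfderiv_add (g.mdiffAt_val hX hY) (g.mdiffAt_val hX' hY),
      mvfderiv_add (g.mdiffAt_val hX hσ) (g.mdiffAt_val hX' hσ), mlieBracket_add_left hX hX']
    simp
    ring

variable {g} in
lemma koszul_tensorial₂ {x : M} {σ X : Π x : M, TangentSpace I x}
    (hσ : MDiffAt (T% σ) x) (hX : MDiffAt (T% X) x) :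
    TensorialAt I E (fun Y ↦ g.koszul σ X Y x) x where
  smul {f Y} hf hY := by
    have e1 : (fun y ↦ g.val y (σ y) ((f • Y) y)) = f * fun y ↦ g.val y (σ y) (Y y) := by
      ext y; simp
    have e2 : (fun y ↦ g.val y (X y) ((f • Y) y)) = f * fun y ↦ g.val y (X y) (Y y) := by
      ext y; simp
    simp only [koszul, e1, e2, mvfderiv_mul hf (g.mdiffAt_val hσ hY),
      mvfderiv_mul hf (g.mdiffAt_val hX hY), mlieBracket_smul_right hf hY]
    simp
    rw [g.symm x (Y x) (X x), g.symm x (Y x) (σ x)]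
    ring
  add {Y Y'} hY hY' := by
    have e1 : (fun y ↦ g.val y (σ y) ((Y + Y') y)) = (fun y ↦ g.val y (σ y) (Y y)) +
        fun y ↦ g.val y (σ y) (Y' y) := by
      ext y; simp
    have e2 : (fun y ↦ g.val y (X y) ((Y + Y') y)) = (fun y ↦ g.val y (X y) (Y y)) +
        fun y ↦ g.val y (X y) (Y' y) := by
      ext y; simp
    simp only [koszul, e1, e2, mvfderiv_add (g.mdiffAt_val hσ hY) (g.mdiffAt_val hσ hY'),
      mvfderiv_add (g.mdiffAt_val hX hY) (g.mdiffAt_val hX hY'), mlieBracket_add_right hY hY']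
    simp
    ring

variable {g} in
lemma koszul_add {x : M} {σ σ' X Y : Π x : M, TangentSpace I x}
    (hσ : MDiffAt (T% σ) x) (hσ' : MDiffAt (T% σ') x)
    (hX : MDiffAt (T% X) x) (hY : MDiffAt (T% Y) x) :
    g.koszul (σ + σ') X Y x = g.koszul σ X Y x + g.koszul σ' X Y x := by
  have e1 : (fun y ↦ g.val y ((σ + σ') y) (Y y)) = (fun y ↦ g.val y (σ y) (Y y)) +
      fun y ↦ g.val y (σ' y) (Y y) := by
    ext y; simp
  have e2 : (fun y ↦ g.val y (X y) ((σ + σ') y)) = (fun y ↦ g.val y (X y) (σ y)) +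
      fun y ↦ g.val y (X y) (σ' y) := by
    ext y; simp
  simp only [koszul, e1, e2, mvfderiv_add (g.mdiffAt_val hσ hY) (g.mdiffAt_val hσ' hY),
    mvfderiv_add (g.mdiffAt_val hX hσ) (g.mdiffAt_val hX hσ'), mlieBracket_add_right hσ hσ',
    mlieBracket_add_left hσ hσ']
  simp
  ring

variable {g} in
lemma koszul_smul {x : M} {f : M → ℝ} {σ X Y : Π x : M, TangentSpace I x}
    (hf : MDiffAt f x) (hσ : MDiffAt (T% σ) x)
    (hX : MDiffAt (T% X) x) (hY : MDiffAt (T% Y) x) :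
    g.koszul (f • σ) X Y x =
      f x * g.koszul σ X Y x + 2 * (d% f x (X x) * g.val x (σ x) (Y x)) := by
  have e1 : (fun y ↦ g.val y ((f • σ) y) (Y y)) = f * fun y ↦ g.val y (σ y) (Y y) := by
    ext y; simp
  have e2 : (fun y ↦ g.val y (X y) ((f • σ) y)) = f * fun y ↦ g.val y (X y) (σ y) := by
    ext y; simp
  simp only [koszul, e1, e2, mvfderiv_mul hf (g.mdiffAt_val hσ hY),
    mvfderiv_mul hf (g.mdiffAt_val hX hσ), mlieBracket_smul_right hf hσ,
    mlieBracket_smul_left hf hσ]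
  simp
  rw [g.symm x (X x) (σ x)]
  ring

open Classical in
/-- The Levi-Civita covariant derivative as a bare function, given by the Koszul formula
`2 g(∇_X σ, Y) = koszul σ X Y` (and by `0` at points where `σ` is not differentiable). -/
def leviCivitaFun (σ : Π x : M, TangentSpace I x) (x : M) :
    TangentSpace I x →L[ℝ] TangentSpace I x :=
  if hσ : MDiffAt (T% σ) x then
    (1 / 2 : ℝ) • g.sharp x ∘L TensorialAt.mkHom₂ (I := I) (F := E) (F' := E)
      (fun X Y ↦ g.koszul σ X Y x) x
      (fun _ hY ↦ koszul_tensorial₁ hσ hY) (fun _ hX ↦ koszul_tensorial₂ hσ hX)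
  else 0

lemma val_leviCivitaFun {x : M} {σ X Y : Π x : M, TangentSpace I x}
    (hσ : MDiffAt (T% σ) x) (hX : MDiffAt (T% X) x) (hY : MDiffAt (T% Y) x) :
    g.val x (g.leviCivitaFun σ x (X x)) (Y x) = g.koszul σ X Y x / 2 := by
  have h1 : TensorialAt.mkHom₂ (I := I) (F := E) (F' := E)
      (fun X Y ↦ g.koszul σ X Y x) x
      (fun _ hY ↦ koszul_tensorial₁ hσ hY) (fun _ hX ↦ koszul_tensorial₂ hσ hX) (X x) (Y x) =
      g.koszul σ X Y x := TensorialAt.mkHom₂_apply _ _ hX hY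
  rw [leviCivitaFun, dif_pos hσ, ← h1]
  simp only [smul_apply, map_smul, ContinuousLinearMap.comp_apply]
  change (1 / 2 : ℝ) • g.val x (g.sharp x _) (Y x) = _
  rw [val_sharp, smul_eq_mul]
  ring

/-- The Levi-Civita connection of a Lorentzian metric. -/
def leviCivita : CovariantDerivative I E (TangentSpace I : M → Type _) where
  toFun := g.leviCivitaFun
  isCovariantDerivativeOnUniv :=
    { add := fun {σ σ' x} hσ hσ' _ ↦ g.ext_of_val fun X Y hX hY ↦ by
        rw [g.val_leviCivitaFun (mdifferentiableAt_add_section hσ hσ') hX hY,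
          koszul_add hσ hσ' hX hY]
        simp only [add_apply, map_add]
        rw [g.val_leviCivitaFun hσ hX hY, g.val_leviCivitaFun hσ' hX hY]
        ring
      leibniz := fun {σ f x} hσ hf _ ↦ g.ext_of_val fun X Y hX hY ↦ by
        rw [g.val_leviCivitaFun (hf.smul_section hσ) hX hY, koszul_smul hf hσ hX hY]
        simp only [add_apply, map_add, smul_apply, map_smul,
          ContinuousLinearMap.smulRight_apply]
        rw [g.val_leviCivitaFun hσ hX hY]
        simp only [smul_eq_mul]
        ring }

/-- The Levi-Civita connection is torsion-free. -/
lemma leviCivita_torsion : g.leviCivita.torsion = 0 := by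
  rw [CovariantDerivative.torsion_eq_zero_iff]
  intro X Y x hX hY
  rw [← sub_eq_zero]
  refine g.eq_zero_of_forall x _ fun w ↦ ?_
  have hW : MDiffAt (T% (FiberBundle.extend E w)) x := FiberBundle.mdifferentiableAt_extend ..
  have h1 := g.val_leviCivitaFun hY hX hW
  have h2 := g.val_leviCivitaFun hX hY hW
  simp only [FiberBundle.extend_apply_self] at h1 h2
  simp only [map_sub, sub_apply]
  change g.val x (g.leviCivitaFun Y x (X x)) w - g.val x (g.leviCivitaFun X x (Y x)) w - _ = 0
  rw [h1, h2]
  have e : (fun y ↦ g.val y (Y y) (X y)) = fun y ↦ g.val y (X y) (Y y) := by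
    ext y; exact g.symm _ _ _
  simp only [koszul, e, mlieBracket_swap_apply (V := Y) (W := X)]
  simp
  ring

/-- The Levi-Civita connection is compatible with the metric. -/
lemma leviCivita_metric {x : M} {X σ τ : Π x : M, TangentSpace I x}
    (hX : MDiffAt (T% X) x) (hσ : MDiffAt (T% σ) x) (hτ : MDiffAt (T% τ) x) :
    d% (fun y ↦ g.val y (σ y) (τ y)) x (X x) =
      g.val x (g.leviCivita σ x (X x)) (τ x) + g.val x (σ x) (g.leviCivita τ x (X x)) := by
  rw [g.symm x (σ x)]
  change _ = g.val x (g.leviCivitaFun σ x (X x)) (τ x) + g.val x (g.leviCivitaFun τ x (X x)) (σ x)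
  rw [g.val_leviCivitaFun hσ hX hτ, g.val_leviCivitaFun hτ hX hσ]
  have e : (fun y ↦ g.val y (τ y) (σ y)) = fun y ↦ g.val y (σ y) (τ y) := by
    ext y; exact g.symm _ _ _
  simp only [koszul, e, mlieBracket_swap_apply (V := τ) (W := σ)]
  simp
  ring

end LorentzianMetric

/-- The coordinate vector field `∂_σ` of a chart `φ`, i.e. the push-forward of the `σ`-th standard
basis vector under `φ⁻¹`; meaningful for `x ∈ φ.source`. -/
def coordVector {n : ℕ} {M : Type*} [TopologicalSpace M]
    [ChartedSpace (EuclideanSpace ℝ (Fin n)) M]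
    (φ : OpenPartialHomeomorph M (EuclideanSpace ℝ (Fin n))) (σ : Fin n) (x : M) :
    TangentSpace (𝓡 n) x :=
  mfderiv (𝓡 n) (𝓡 n) φ.symm (φ x) (EuclideanSpace.single σ (1 : ℝ))

namespace LorentzianMetric

variable {n : ℕ} {M : Type*} [TopologicalSpace M] [ChartedSpace (EuclideanSpace ℝ (Fin n)) M]
  [IsManifold (𝓡 n) ∞ M]

/-- The metric component `g_{σρ} = g(∂_σ, ∂_ρ)` in the chart `φ`. -/
def component (g : LorentzianMetric (𝓡 n) M)
    (φ : OpenPartialHomeomorph M (EuclideanSpace ℝ (Fin n))) (σ ρ : Fin n) (x : M) : ℝ :=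
  g.val x (coordVector φ σ x) (coordVector φ ρ x)

/-- The subset `S` of `M` is a smooth embedded submanifold of dimension `k`, and the metric `g`
restricts to a smooth Riemannian metric on it. -/
def IsRiemannianSubmanifold (g : LorentzianMetric (𝓡 n) M) (k : ℕ) (S : Set M) : Prop :=
  ∃ (_ : ChartedSpace (EuclideanSpace ℝ (Fin k)) S) (_ : IsManifold (𝓡 k) ∞ S),
    Manifold.IsSmoothEmbedding (𝓡 k) (𝓡 n) ∞ (Subtype.val : S → M) ∧
    ∃ h : ContMDiffRiemannianMetric (𝓡 k) ∞ (EuclideanSpace ℝ (Fin k))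
        (TangentSpace (𝓡 k) : S → Type _),
      ∀ (p : S) (v w : TangentSpace (𝓡 k) p),
        h.inner p v w = g.val (p : M)
          (mfderiv (𝓡 k) (𝓡 n) (Subtype.val : S → M) p v)
          (mfderiv (𝓡 k) (𝓡 n) (Subtype.val : S → M) p w)

end LorentzianMetric

/-- The chart `φ = (u, v, x¹, …, xᵐ)` is adapted to `Z`, i.e. `Z = ∂_v = grad u` on its domain.
The coordinates `u`, `v`, `xᵃ` have the indices `0`, `1`, `a.succ.succ`. -/
structure IsAdaptedChart {m : ℕ} {M : Type*} [TopologicalSpace M]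
    [ChartedSpace (EuclideanSpace ℝ (Fin (m + 2))) M] [IsManifold (𝓡 (m + 2)) ∞ M]
    (g : LorentzianMetric (𝓡 (m + 2)) M) (Z : Π x : M, TangentSpace (𝓡 (m + 2)) x)
    (φ : OpenPartialHomeomorph M (EuclideanSpace ℝ (Fin (m + 2)))) : Prop where
  mem_maximalAtlas : φ ∈ IsManifold.maximalAtlas (𝓡 (m + 2)) ∞ M
  eq_coordVector : ∀ x ∈ φ.source, Z x = coordVector φ 1 x
  eq_grad : ∀ x ∈ φ.source, Z x = g.grad (fun y ↦ φ y 0) x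

end

/-!
Near a point of the chart domain, `Z = ∂_v` is parallel and commutes with the coordinate fields, so
`∇_Z ∂_σ = ∇_{∂_σ} Z = 0` and `∂_v g_{σρ} = 0` by metric compatibility. As `g(Z, ·) = du`, item 2
reads off `du(∂_σ)`. By the signature, a vector of `ker du = Z^⊥` is spacelike or a multiple of
the null vector `Z`, and `dv(Z) = 1` excludes nonzero multiples on `ker dv`. So `g` is positive
definite on `ker du ∩ ker dv`, which contains the span of the `∂_a` and the tangent spaces of the
slices `{u = c, v = d}`.
-/

section LinearAlgebra

open LinearMap (BilinForm)

variable {V : Type*} [AddCommGroup V] [Module ℝ V] {B : BilinForm ℝ V}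

/-- A basis in which the bilinear form `B` is the Minkowski form `-x₀ y₀ + x₁ y₁ + ⋯ + xₖ yₖ`. -/
def IsLorentzBasis (B : BilinForm ℝ V) {k : ℕ} (b : Module.Basis (Fin (k + 1)) ℝ V) : Prop :=
  ∀ i j, B (b i) (b j) = if i = j then (if i = 0 then -1 else 1) else 0

namespace IsLorentzBasis

variable {k : ℕ} {b : Module.Basis (Fin (k + 1)) ℝ V}

lemma apply_eq (hb : IsLorentzBasis B b) (v w : V) :
    B v w = -(b.repr v 0 * b.repr w 0) + ∑ i : Fin k, b.repr v i.succ * b.repr w i.succ := by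
  rw [← LinearMap.BilinForm.sum_repr_mul_repr_mul b v w]
  simp [Finsupp.sum_fintype, Fin.sum_univ_succ, hb _ _, Fin.succ_ne_zero]

lemma eq_zero_of_apply_self_nonpos (hb : IsLorentzBasis B b) {v : V} (h0 : b.repr v 0 = 0)
    (hv : B v v ≤ 0) : v = 0 := by
  have hsum : ∑ i : Fin k, b.repr v i.succ * b.repr v i.succ ≤ 0 := by
    simpa [hb.apply_eq, h0] using hv
  rw [(Finset.sum_nonneg fun i _ ↦ mul_self_nonneg _).ge_iff_eq',
    Finset.sum_eq_zero_iff_of_nonneg fun i _ ↦ mul_self_nonneg _] at hsum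
  exact b.ext_elem (Fin.cases (by simpa using h0) fun i ↦ by simpa using hsum i (Finset.mem_univ i))

lemma apply_self_pos_of_orthogonal_null (hb : IsLorentzBasis B b) {z v : V} (hz : z ≠ 0)
    (hzz : B z z = 0) (hzv : B z v = 0) (hv : v ∉ Submodule.span ℝ {z}) : 0 < B v v := by
  have hz0 : b.repr z 0 ≠ 0 := fun h ↦ hz (hb.eq_zero_of_apply_self_nonpos h hzz.le)
  have hvz : B v z = 0 := by simpa only [hb.apply_eq, mul_comm] using hzv
  by_contra! hvv
  -- Subtracting a multiple of `z` does not change `B v v`, and can be used to make `v` spatial.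
  set t := b.repr v 0 / b.repr z 0
  have hsub : v - t • z = 0 := hb.eq_zero_of_apply_self_nonpos (by simp [t, hz0])
    (by simpa [hzz, hzv, hvz] using hvv)
  exact hv (Submodule.mem_span_singleton.2 ⟨t, (sub_eq_zero.1 hsub).symm⟩)

end IsLorentzBasis

open Matrix in
lemma posDef_gram_of_forall_pos {ι : Type*} [Fintype ι] (hB : B.IsSymm) {v : ι → V}
    (hv : ∀ c : ι → ℝ, c ≠ 0 → 0 < B (∑ i, c i • v i) (∑ i, c i • v i)) :
    (Matrix.of fun i j ↦ B (v i) (v j)).PosDef := by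
  refine .of_dotProduct_mulVec_pos (Matrix.ext fun i j ↦ hB.eq _ _) fun c hc ↦ ?_
  have hgram : B (∑ i, c i • v i) (∑ i, c i • v i) =
      star c ⬝ᵥ (Matrix.of fun i j ↦ B (v i) (v j)) *ᵥ c := by
    rw [LinearMap.BilinForm.sum_left]
    simp only [map_sum, map_smul, LinearMap.smul_apply, smul_eq_mul, dotProduct, mulVec, of_apply,
      Pi.star_apply, star_trivial, Finset.mul_sum]
    exact Finset.sum_congr rfl fun i _ ↦ Finset.sum_congr rfl fun j _ ↦ by ring
  exact hgram ▸ hv c hc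

end LinearAlgebra

namespace LorentzianMetric

variable {E : Type*} [NormedAddCommGroup E] [NormedSpace ℝ E]
  {H : Type*} [TopologicalSpace H] {I : ModelWithCorners ℝ E H}
  {M : Type*} [TopologicalSpace M] [ChartedSpace H M] [IsManifold I ∞ M]
  (g : LorentzianMetric I M)

lemma val_self_pos_of_orthogonal_null {x : M} {z v : TangentSpace I x} (hz : z ≠ 0)
    (hzz : g.val x z z = 0) (hzv : g.val x z v = 0) (hv : v ∉ Submodule.span ℝ {z}) :
    0 < g.val x v v := by
  obtain ⟨k, b, hb⟩ := g.signature x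
  have hb : IsLorentzBasis (g.bilin x) b := hb
  exact hb.apply_self_pos_of_orthogonal_null hz hzz hzv hv

variable [FiniteDimensional ℝ E]

lemma val_grad (f : M → ℝ) (x : M) (w : TangentSpace I x) :
    g.val x (g.grad f x) w = d% f x w :=
  g.val_sharp x _ w

open VectorField

lemma leviCivita_apply_eq_zero_of_parallel {x : M} {Z X : Π x : M, TangentSpace I x}
    (hZ : MDiffAt (T% Z) x) (hX : MDiffAt (T% X) x) (hpar : g.leviCivita Z x = 0)
    (hZX : mlieBracket I Z X x = 0) : g.leviCivita X x (Z x) = 0 := by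
  have htorsion := (CovariantDerivative.torsion_eq_zero_iff _).1 g.leviCivita_torsion hZ hX
  simpa [hpar, hZX] using htorsion

lemma mvfderiv_val_eq_zero_of_parallel {x : M} {Z X Y : Π x : M, TangentSpace I x}
    (hZ : MDiffAt (T% Z) x) (hX : MDiffAt (T% X) x) (hY : MDiffAt (T% Y) x)
    (hpar : g.leviCivita Z x = 0)
    (hZX : mlieBracket I Z X x = 0) (hZY : mlieBracket I Z Y x = 0) :
    d% (fun y ↦ g.val y (X y) (Y y)) x (Z x) = 0 := by
  rw [g.leviCivita_metric hZ hX hY, g.leviCivita_apply_eq_zero_of_parallel hZ hX hpar hZX,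
    g.leviCivita_apply_eq_zero_of_parallel hZ hY hpar hZY]
  simp

end LorentzianMetric

open Topology

section GeneralModels

variable {𝕜 : Type*} [NontriviallyNormedField 𝕜]
  {E : Type*} [NormedAddCommGroup E] [NormedSpace 𝕜 E]
  {H : Type*} [TopologicalSpace H] {I : ModelWithCorners 𝕜 E H}
  {M : Type*} [TopologicalSpace M] [ChartedSpace H M]
  {E' : Type*} [NormedAddCommGroup E'] [NormedSpace 𝕜 E']
  {H' : Type*} [TopologicalSpace H'] {J : ModelWithCorners 𝕜 E' H'}
  {N : Type*} [TopologicalSpace N] [ChartedSpace H' N]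

lemma mdifferentiable_of_mem_maximalAtlas {n : ℕ∞ω} (hn : n ≠ 0) {φ : OpenPartialHomeomorph M H}
    (hφ : φ ∈ IsManifold.maximalAtlas I n M) : φ.MDifferentiable I I :=
  ⟨(contMDiffOn_of_mem_maximalAtlas hφ).mdifferentiableOn hn,
    (contMDiffOn_symm_of_mem_maximalAtlas hφ).mdifferentiableOn hn⟩

lemma mvfderiv_mfderiv_eq_zero_of_comp_eq_const {f : N → M} {h : M → 𝕜} {c : 𝕜} {p : N}
    (hh : MDiffAt h (f p)) (hf : MDiffAt f p) (hc : ∀ q, h (f q) = c) (v : TangentSpace J p) :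
    d% h (f p) (mfderiv J I f p v) = 0 := by
  rw [← mvfderiv_comp_apply p hh hf, show h ∘ f = fun _ ↦ c from funext hc, mvfderiv_const,
    zero_apply]

end GeneralModels

section ConstantVectorField

variable {𝕜 : Type*} [NontriviallyNormedField 𝕜] {E : Type*} [NormedAddCommGroup E]
  [NormedSpace 𝕜 E]

variable (𝕜) in
/-- The vector field on a normed space with constant value `v`. -/
def constVectorField (v : E) (y : E) : TangentSpace 𝓘(𝕜, E) y := v

lemma mdifferentiableAt_constVectorField (v y : E) : MDiffAt (T% (constVectorField 𝕜 v)) y :=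
  (contMDiffAt_vectorSpace_iff_contDiffAt (n := 1)
    (V := constVectorField 𝕜 v).2 contDiffAt_const).mdifferentiableAt one_ne_zero

lemma mlieBracket_constVectorField (v w : E) :
    VectorField.mlieBracket 𝓘(𝕜, E) (constVectorField 𝕜 v) (constVectorField 𝕜 w) = 0 := by
  ext y
  have h : VectorField.lieBracket 𝕜 (fun _ : E ↦ v) (fun _ ↦ w) y = 0 := by
    simp [VectorField.lieBracket]
  rw [← VectorField.mlieBracketWithin_univ, VectorField.mlieBracketWithin_eq_lieBracketWithin]
  exact (congrFun VectorField.lieBracketWithin_univ y).trans h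

end ConstantVectorField

section CoordinateFields

open VectorField

variable {n : ℕ} {M : Type*} [TopologicalSpace M] [ChartedSpace (EuclideanSpace ℝ (Fin n)) M]
  {φ : OpenPartialHomeomorph M (EuclideanSpace ℝ (Fin n))} {x : M}

lemma mdifferentiableAt_coord (hφ : φ ∈ IsManifold.maximalAtlas (𝓡 n) ∞ M) (hx : x ∈ φ.source)
    (σ : Fin n) : MDifferentiableAt (𝓡 n) 𝓘(ℝ) (fun y ↦ φ y σ) x :=
  (EuclideanSpace.proj (𝕜 := ℝ) σ).differentiableAt.comp_mdifferentiableAt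
    ((mdifferentiable_of_mem_maximalAtlas (by simp) hφ).mdifferentiableAt hx)

lemma hasLineDerivAt_comp_symm (hφ : φ ∈ IsManifold.maximalAtlas (𝓡 n) ∞ M) (hx : x ∈ φ.source)
    {f : M → ℝ} (hf : MDifferentiableAt (𝓡 n) 𝓘(ℝ) f x) (σ : Fin n) :
    HasLineDerivAt ℝ (f ∘ φ.symm) (mvfderiv (𝓡 n) f x (coordVector φ σ x)) (φ x)
      (EuclideanSpace.single σ 1) := by
  have hsymm : MDifferentiableAt (𝓡 n) (𝓡 n) φ.symm (φ x) :=
    (mdifferentiable_of_mem_maximalAtlas (by simp) hφ).mdifferentiableAt_symm (φ.map_source hx)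
  have hcomp : MDifferentiableAt (𝓡 n) 𝓘(ℝ) (f ∘ φ.symm) (φ x) :=
    hf.comp_of_eq _ hsymm (φ.left_inv hx)
  have hchain : mvfderiv 𝓘(ℝ, EuclideanSpace ℝ (Fin n)) (f ∘ φ.symm) (φ x)
      (EuclideanSpace.single σ (1 : ℝ)) = mvfderiv (𝓡 n) f x (coordVector φ σ x) :=
    mvfderiv_comp_apply_of_eq _ hf hsymm (φ.left_inv hx) _
  exact hchain ▸ hcomp.hasMFDerivAt.hasFDerivAt.hasLineDerivAt _

lemma mvfderiv_coord_coordVector (hφ : φ ∈ IsManifold.maximalAtlas (𝓡 n) ∞ M)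
    (hx : x ∈ φ.source) (σ ρ : Fin n) :
    mvfderiv (𝓡 n) (fun y ↦ φ y ρ) x (coordVector φ σ x) = if ρ = σ then 1 else 0 := by
  have hinv : (fun y ↦ φ y ρ) ∘ φ.symm =ᶠ[𝓝 (φ x)] EuclideanSpace.proj (𝕜 := ℝ) ρ := by
    filter_upwards [φ.open_target.mem_nhds (φ.map_source hx)] with y hy
    simp [φ.right_inv hy]
  have hline := hasLineDerivAt_comp_symm hφ hx (mdifferentiableAt_coord hφ hx ρ) σ
  rw [hinv.hasLineDerivAt_iff] at hline
  rw [hline.unique (((EuclideanSpace.proj (𝕜 := ℝ) ρ).hasFDerivAt).hasLineDerivAt _)]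
  simp

lemma coordVector_eventuallyEq_mpullback (hφ : φ ∈ IsManifold.maximalAtlas (𝓡 n) ∞ M)
    (hx : x ∈ φ.source) (σ : Fin n) :
    coordVector φ σ =ᶠ[𝓝 x]
      mpullback (𝓡 n) (𝓡 n) φ (constVectorField ℝ (EuclideanSpace.single σ 1)) := by
  filter_upwards [φ.open_source.mem_nhds hx] with y hy
  let e := (mdifferentiable_of_mem_maximalAtlas (by simp) hφ).mfderiv hy
  have he : mfderiv (𝓡 n) (𝓡 n) φ y = (e : TangentSpace (𝓡 n) y →L[ℝ] _) := rfl
  rw [mpullback_apply, he, ContinuousLinearMap.inverse_equiv]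
  rfl

variable [IsManifold (𝓡 n) ∞ M]

lemma mdifferentiableAt_coordVector (hφ : φ ∈ IsManifold.maximalAtlas (𝓡 n) ∞ M)
    (hx : x ∈ φ.source) (σ : Fin n) : MDifferentiableAt (𝓡 n) (𝓡 n).tangent
      (fun y ↦ (⟨y, coordVector φ σ y⟩ : TangentBundle (𝓡 n) M)) x := by
  have hinv : (mfderiv (𝓡 n) (𝓡 n) φ x).IsInvertible :=
    ⟨(mdifferentiable_of_mem_maximalAtlas (by simp) hφ).mfderiv hx, rfl⟩
  refine ((mdifferentiableAt_constVectorField (EuclideanSpace.single σ 1) _).mpullback_vectorField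
    (contMDiffAt_of_mem_maximalAtlas hφ hx) hinv ENat.LEInfty.out).congr_of_eventuallyEq ?_
  filter_upwards [coordVector_eventuallyEq_mpullback hφ hx σ] with y hy
  rw [hy]

lemma mlieBracket_coordVector (hφ : φ ∈ IsManifold.maximalAtlas (𝓡 n) ∞ M)
    (hx : x ∈ φ.source) (σ ρ : Fin n) :
    mlieBracket (𝓡 n) (coordVector φ σ) (coordVector φ ρ) x = 0 := by
  have h2 : minSmoothness ℝ 2 ≤ ∞ := by simpa using ENat.LEInfty.out
  have : IsManifold (𝓡 n) (minSmoothness ℝ 2) M := .of_le h2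
  rw [(coordVector_eventuallyEq_mpullback hφ hx σ).mlieBracket_vectorField_eq
    (coordVector_eventuallyEq_mpullback hφ hx ρ), ← mpullback_mlieBracket
    (mdifferentiableAt_constVectorField _ _) (mdifferentiableAt_constVectorField _ _)
    (contMDiffAt_of_mem_maximalAtlas hφ hx) h2, mlieBracket_constVectorField, mpullback_zero]
  rfl

end CoordinateFields

namespace IsAdaptedChart

variable {m : ℕ} {M : Type*} [TopologicalSpace M]
  [ChartedSpace (EuclideanSpace ℝ (Fin (m + 2))) M] [IsManifold (𝓡 (m + 2)) ∞ M]
  {g : LorentzianMetric (𝓡 (m + 2)) M} {Z : Π x : M, TangentSpace (𝓡 (m + 2)) x}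
  {φ : OpenPartialHomeomorph M (EuclideanSpace ℝ (Fin (m + 2)))} {x : M}

lemma eventuallyEq_coordVector (hφ : IsAdaptedChart g Z φ) (hx : x ∈ φ.source) :
    Z =ᶠ[𝓝 x] coordVector φ 1 :=
  Filter.eventually_of_mem (φ.open_source.mem_nhds hx) hφ.eq_coordVector

lemma mdifferentiableAt (hφ : IsAdaptedChart g Z φ) (hx : x ∈ φ.source) :
    MDifferentiableAt (𝓡 (m + 2)) (𝓡 (m + 2)).tangent
      (fun y ↦ (⟨y, Z y⟩ : TangentBundle (𝓡 (m + 2)) M)) x := by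
  refine (mdifferentiableAt_coordVector hφ.mem_maximalAtlas hx 1).congr_of_eventuallyEq ?_
  filter_upwards [hφ.eventuallyEq_coordVector hx] with y hy
  rw [hy]

lemma mlieBracket_eq_zero (hφ : IsAdaptedChart g Z φ) (hx : x ∈ φ.source)
    (σ : Fin (m + 2)) : VectorField.mlieBracket (𝓡 (m + 2)) Z (coordVector φ σ) x = 0 := by
  rw [(hφ.eventuallyEq_coordVector hx).mlieBracket_vectorField_eq (.refl _ (coordVector φ σ)),
    mlieBracket_coordVector hφ.mem_maximalAtlas hx]

lemma val_apply (hφ : IsAdaptedChart g Z φ) (hx : x ∈ φ.source)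
    (v : TangentSpace (𝓡 (m + 2)) x) :
    g.val x (Z x) v = mvfderiv (𝓡 (m + 2)) (fun y ↦ φ y 0) x v := by
  rw [hφ.eq_grad x hx, g.val_grad]

lemma mvfderiv_coord (hφ : IsAdaptedChart g Z φ) (hx : x ∈ φ.source) (ρ : Fin (m + 2)) :
    mvfderiv (𝓡 (m + 2)) (fun y ↦ φ y ρ) x (Z x) = if ρ = 1 then 1 else 0 := by
  rw [hφ.eq_coordVector x hx, mvfderiv_coord_coordVector hφ.mem_maximalAtlas hx]

lemma ne_zero (hφ : IsAdaptedChart g Z φ) (hx : x ∈ φ.source) : Z x ≠ 0 := fun h ↦ by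
  simpa [h] using hφ.mvfderiv_coord hx 1

lemma val_self (hφ : IsAdaptedChart g Z φ) (hx : x ∈ φ.source) : g.val x (Z x) (Z x) = 0 := by
  rw [hφ.val_apply hx, hφ.mvfderiv_coord hx, if_neg (by simp)]

lemma component_one (hφ : IsAdaptedChart g Z φ) (hx : x ∈ φ.source) (σ : Fin (m + 2)) :
    g.component φ 1 σ x = if σ = 0 then 1 else 0 := by
  rw [LorentzianMetric.component, ← hφ.eq_coordVector x hx, hφ.val_apply hx,
    mvfderiv_coord_coordVector hφ.mem_maximalAtlas hx]
  simp only [eq_comm]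

lemma hasLineDerivAt_component (hφ : IsAdaptedChart g Z φ) (hx : x ∈ φ.source)
    (hpar : g.leviCivita Z x = 0) (σ ρ : Fin (m + 2)) :
    HasLineDerivAt ℝ (fun y ↦ g.component φ σ ρ (φ.symm y)) 0 (φ x)
      (EuclideanSpace.single 1 (1 : ℝ)) := by
  have hσ := mdifferentiableAt_coordVector hφ.mem_maximalAtlas hx σ
  have hρ := mdifferentiableAt_coordVector hφ.mem_maximalAtlas hx ρ
  have hzero : mvfderiv (𝓡 (m + 2)) (g.component φ σ ρ) x (coordVector φ 1 x) = 0 :=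
    hφ.eq_coordVector x hx ▸ g.mvfderiv_val_eq_zero_of_parallel (hφ.mdifferentiableAt hx) hσ hρ hpar
      (hφ.mlieBracket_eq_zero hx σ) (hφ.mlieBracket_eq_zero hx ρ)
  exact hzero ▸ hasLineDerivAt_comp_symm hφ.mem_maximalAtlas hx (g.mdiffAt_val hσ hρ) 1

lemma val_self_pos (hφ : IsAdaptedChart g Z φ) (hx : x ∈ φ.source)
    {v : TangentSpace (𝓡 (m + 2)) x} (hv : v ≠ 0)
    (hdu : mvfderiv (𝓡 (m + 2)) (fun y ↦ φ y 0) x v = 0)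
    (hdv : mvfderiv (𝓡 (m + 2)) (fun y ↦ φ y 1) x v = 0) : 0 < g.val x v v := by
  refine g.val_self_pos_of_orthogonal_null (hφ.ne_zero hx) (hφ.val_self hx)
    ((hφ.val_apply hx v).trans hdu) fun hspan ↦ ?_
  obtain ⟨t, rfl⟩ := Submodule.mem_span_singleton.1 hspan
  rw [map_smul, hφ.mvfderiv_coord hx] at hdv
  have ht : t = 0 := by simpa using hdv
  exact hv (by rw [ht, zero_smul])

lemma posDef_component (hφ : IsAdaptedChart g Z φ) (hx : x ∈ φ.source) :
    (Matrix.of fun a b : Fin m ↦ g.component φ a.succ.succ b.succ.succ x).PosDef := by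
  refine posDef_gram_of_forall_pos (B := g.bilin x) ⟨fun v w ↦ g.symm x v w⟩ fun c hc ↦ ?_
  have hcoord (ρ : Fin (m + 2)) :
      mvfderiv (𝓡 (m + 2)) (fun y ↦ φ y ρ) x (∑ a, c a • coordVector φ a.succ.succ x) =
        ∑ a, c a * if ρ = a.succ.succ then 1 else 0 := by
    simp only [map_sum, map_smul, mvfderiv_coord_coordVector hφ.mem_maximalAtlas hx, smul_eq_mul]
  refine hφ.val_self_pos hx (fun h ↦ hc (funext fun a ↦ ?_)) ?_ ?_
  · simpa [h] using (hcoord a.succ.succ).symm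
  · simp [hcoord, (Fin.succ_ne_zero _).symm]
  · simp [hcoord, (Fin.succ_succ_ne_one _).symm]

end IsAdaptedChart

section InducedMetric

lemma isCoercive_of_forall_pos {V : Type*} [NormedAddCommGroup V] [NormedSpace ℝ V]
    [FiniteDimensional ℝ V] {B : V →L[ℝ] V →L[ℝ] ℝ} (hB : ∀ v, v ≠ 0 → 0 < B v v) :
    IsCoercive B := by
  rcases subsingleton_or_nontrivial V with _ | _
  · exact ⟨1, one_pos, fun v ↦ by simp [Subsingleton.elim v 0]⟩
  obtain ⟨w, hw, hmin⟩ := (isCompact_sphere (0 : V) 1).exists_isMinOn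
    (NormedSpace.sphere_nonempty.2 zero_le_one)
    (by fun_prop : Continuous fun v ↦ B v v).continuousOn
  refine ⟨B w w, hB w (ne_zero_of_mem_unit_sphere ⟨w, hw⟩), fun v ↦ ?_⟩
  rcases eq_or_ne v 0 with rfl | hv
  · simp
  have hunit : B w w ≤ ‖v‖⁻¹ * (‖v‖⁻¹ * B v v) := by
    simpa using hmin (by simp [norm_smul, hv] : ‖v‖⁻¹ • v ∈ Metric.sphere (0 : V) 1)
  have : 0 < ‖v‖ := norm_pos_iff.2 hv
  calc B w w * ‖v‖ * ‖v‖ ≤ ‖v‖⁻¹ * (‖v‖⁻¹ * B v v) * ‖v‖ * ‖v‖ := by gcongr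
    _ = B v v := by field_simp

lemma isVonNBounded_of_isCoercive {V : Type*} [NormedAddCommGroup V] [NormedSpace ℝ V]
    {B : V →L[ℝ] V →L[ℝ] ℝ} (hB : IsCoercive B) :
    Bornology.IsVonNBounded ℝ {v : V | B v v < 1} := by
  obtain ⟨C, hC, hle⟩ := hB
  rw [NormedSpace.isVonNBounded_iff]
  refine Metric.isBounded_iff_subset_closedBall 0 |>.2 ⟨√(1 / C), fun v (hv : B v v < 1) ↦ ?_⟩
  rw [mem_closedBall_zero_iff]
  refine Real.le_sqrt_of_sq_le ((le_div_iff₀' hC).2 ?_)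
  linarith [hle v]

lemma contMDiffAt_clm_of_forall_apply {𝕜 : Type*} [NontriviallyNormedField 𝕜] [CompleteSpace 𝕜]
    {V F : Type*} [NormedAddCommGroup V] [NormedSpace 𝕜 V] [FiniteDimensional 𝕜 V]
    [NormedAddCommGroup F] [NormedSpace 𝕜 F]
    {E : Type*} [NormedAddCommGroup E] [NormedSpace 𝕜 E] {H : Type*} [TopologicalSpace H]
    {I : ModelWithCorners 𝕜 E H} {M : Type*} [TopologicalSpace M] [ChartedSpace H M]
    {n : ℕ∞ω} {f : M → V →L[𝕜] F} {x : M}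
    (h : ∀ v, ContMDiffAt I 𝓘(𝕜, F) n (fun y ↦ f y v) x) :
    ContMDiffAt I 𝓘(𝕜, V →L[𝕜] F) n f x := by
  let e₁ : V ≃L[𝕜] (Fin (Module.finrank 𝕜 V) → 𝕜) :=
    ContinuousLinearEquiv.ofFinrankEq (Module.finrank_fin_fun 𝕜).symm
  let e₂ := (e₁.arrowCongr (1 : F ≃L[𝕜] F)).trans
    (ContinuousLinearEquiv.piRing (Fin (Module.finrank 𝕜 V)))
  rw [← Function.id_comp f, ← e₂.symm_comp_self]
  exact e₂.symm.contDiff.contMDiff.contMDiffAt.comp x (contMDiffAt_pi_space.2 fun i ↦ h _)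

variable {E : Type*} [NormedAddCommGroup E] [NormedSpace ℝ E]
  {H : Type*} [TopologicalSpace H] {I : ModelWithCorners ℝ E H}
  {M : Type*} [TopologicalSpace M] [ChartedSpace H M]
  {E' : Type*} [NormedAddCommGroup E'] [NormedSpace ℝ E']
  {H' : Type*} [TopologicalSpace H'] {J : ModelWithCorners ℝ E' H'}
  {N : Type*} [TopologicalSpace N] [ChartedSpace H' N]

variable (J) in
/-- The pullback `f^* B` of a field `B` of bilinear forms on the tangent spaces of `M` under a map
`f : N → M`. -/
noncomputable def pullbackBilin
    (B : Π x : M, TangentSpace I x →L[ℝ] TangentSpace I x →L[ℝ] ℝ) (f : N → M) (p : N) :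
    TangentSpace J p →L[ℝ] TangentSpace J p →L[ℝ] ℝ :=
  ContinuousLinearMap.bilinearComp (E := E) (F := E) (E' := E') (F' := E') (G := ℝ)
    (B (f p)) (mfderiv J I f p) (mfderiv J I f p)

variable [IsManifold I ∞ M] [IsManifold J ∞ N]

variable (I) in
/-- Smoothness of a field of bilinear forms on the tangent spaces of `M`, as a section of the
bundle of continuous bilinear forms. -/
def ContMDiffBilin (B : Π x : M, TangentSpace I x →L[ℝ] TangentSpace I x →L[ℝ] ℝ) : Prop :=
  ContMDiff I (I.prod 𝓘(ℝ, E →L[ℝ] E →L[ℝ] ℝ)) ∞ fun x ↦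
    TotalSpace.mk' (E →L[ℝ] E →L[ℝ] ℝ)
      (E := fun x : M ↦ TangentSpace I x →L[ℝ] TangentSpace I x →L[ℝ] ℝ) x (B x)

lemma contMDiffAt_trivialization_symm (p₀ : N) (v : E') :
    ContMDiffAt J J.tangent ∞ (fun p ↦
      (⟨p, (trivializationAt E' (TangentSpace J) p₀).symm p v⟩ : TangentBundle J N)) p₀ := by
  set e := trivializationAt E' (TangentSpace J : N → Type _) p₀
  have hp₀ : p₀ ∈ e.baseSet := FiberBundle.mem_baseSet_trivializationAt' p₀
  refine (e.contMDiffAt_section_iff hp₀).2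
    ((contMDiffAt_const (c := v)).congr_of_eventuallyEq ?_)
  filter_upwards [e.open_baseSet.mem_nhds hp₀] with p hp
  simp [e.apply_mk_symm hp]

variable {B : Π x : M, TangentSpace I x →L[ℝ] TangentSpace I x →L[ℝ] ℝ} {f : N → M}

lemma contMDiffAt_pullbackBilin_apply
    (hB : ContMDiffBilin I B)
    (hf : ContMDiff J I ∞ f) {p : N} {X Y : Π p : N, TangentSpace J p}
    (hX : ContMDiffAt J J.tangent ∞ (fun q ↦ (⟨q, X q⟩ : TangentBundle J N)) p)
    (hY : ContMDiffAt J J.tangent ∞ (fun q ↦ (⟨q, Y q⟩ : TangentBundle J N)) p) :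
    ContMDiffAt J 𝓘(ℝ) ∞ (fun q ↦ pullbackBilin J B f q (X q) (Y q)) p := by
  have hdf := hf.contMDiff_tangentMap (m := ∞) (by simp)
  exact (contMDiffAt_totalSpace.1 (ContMDiffAt.clm_bundle_apply₂ (F₁ := E) (F₂ := E) (F₃ := ℝ)
    (E₃ := Bundle.Trivial M ℝ) (hB.contMDiffAt.comp p hf.contMDiffAt)
    (hdf.contMDiffAt.comp p hX) (hdf.contMDiffAt.comp p hY))).2

lemma contMDiff_pullbackBilin [FiniteDimensional ℝ E']
    (hB : ContMDiffBilin I B)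
    (hf : ContMDiff J I ∞ f) :
    ContMDiffBilin J (pullbackBilin J B f) := by
  intro p₀
  rw [contMDiffAt_hom_bundle]
  refine ⟨contMDiffAt_id, contMDiffAt_clm_of_forall_apply fun v ↦
    contMDiffAt_clm_of_forall_apply fun w ↦ ?_⟩
  refine (contMDiffAt_pullbackBilin_apply hB hf (contMDiffAt_trivialization_symm p₀ v)
    (contMDiffAt_trivialization_symm p₀ w)).congr_of_eventuallyEq ?_
  let e := trivializationAt E' (TangentSpace J : N → Type _) p₀
  filter_upwards [e.open_baseSet.mem_nhds (FiberBundle.mem_baseSet_trivializationAt' p₀)] with p hp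
  rw [inCoordinates_apply_eq₂ hp hp (Set.mem_univ _)]
  simp

/-- The Riemannian metric induced by a smooth map `f : N → M` from a symmetric field `B` of
bilinear forms on `M`, such as a pseudo-Riemannian metric, whose pullback is positive definite. -/
noncomputable def inducedRiemannianMetric [FiniteDimensional ℝ E']
    (hB : ContMDiffBilin I B)
    (hsymm : ∀ x v w, B x v w = B x w v) (hf : ContMDiff J I ∞ f)
    (hpos : ∀ (p : N) (v : TangentSpace J p), v ≠ 0 → 0 < pullbackBilin J B f p v v) :
    ContMDiffRiemannianMetric J ∞ E' (TangentSpace J : N → Type _) where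
  inner := pullbackBilin J B f
  symm _ _ _ := hsymm _ _ _
  pos := hpos
  isVonNBounded p := isVonNBounded_of_isCoercive (V := E') (isCoercive_of_forall_pos (hpos p))
  contMDiff := contMDiff_pullbackBilin hB hf

end InducedMetric

section Immersion

variable {𝕜 : Type*} [NontriviallyNormedField 𝕜]
  {E : Type*} [NormedAddCommGroup E] [NormedSpace 𝕜 E]
  {H : Type*} [TopologicalSpace H] {I : ModelWithCorners 𝕜 E H}
  {M : Type*} [TopologicalSpace M] [ChartedSpace H M]
  {E' : Type*} [NormedAddCommGroup E'] [NormedSpace 𝕜 E']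
  {H' : Type*} [TopologicalSpace H'] {J : ModelWithCorners 𝕜 E' H'}
  {N : Type*} [TopologicalSpace N] [ChartedSpace H' N] {n : ℕ∞ω}

lemma mfderiv_extend_injective (hn : n ≠ 0) {φ : OpenPartialHomeomorph M H} {x : M}
    (hφ : φ ∈ IsManifold.maximalAtlas I n M) (hx : x ∈ φ.source) :
    Function.Injective (mfderiv I 𝓘(𝕜, E) (φ.extend I) x) := by
  have hφ' := mdifferentiable_of_mem_maximalAtlas hn hφ
  have hI : HasMFDerivAt I 𝓘(𝕜, E) I (φ x) (ContinuousLinearMap.id 𝕜 E) := I.hasMFDerivAt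
  have hcomp := hI.comp x (hφ'.mdifferentiableAt hx).hasMFDerivAt
  rw [show (φ.extend I : M → E) = I ∘ φ from φ.extend_coe, hcomp.mfderiv]
  exact hφ'.mfderiv_injective hx

lemma mfderiv_injective_of_isImmersionAt (hn : n ≠ 0) {f : M → N} {x : M}
    (hf : Manifold.IsImmersionAt I J n f x) : Function.Injective (mfderiv I J f x) := by
  have hfx : MDiffAt f x := hf.contMDiffAt.mdifferentiableAt hn
  obtain ⟨F, _, _, h⟩ := hf
  let proj : E' →L[𝕜] E := (ContinuousLinearMap.fst 𝕜 E F).comp (h.equiv.symm : E' →L[𝕜] E × F)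
  have hcod : MDifferentiableAt J 𝓘(𝕜, E) (proj ∘ h.codChart.extend J) (f x) :=
    proj.differentiableAt.comp_mdifferentiableAt ((OpenPartialHomeomorph.contMDiffAt_extend
      h.codChart_mem_maximalAtlas h.mem_codChart_source).mdifferentiableAt hn)
  have hleft : (proj ∘ h.codChart.extend J) ∘ f =ᶠ[𝓝 x] h.domChart.extend I := by
    filter_upwards [h.domChart.open_source.mem_nhds h.mem_domChart_source] with y hy
    have hy' : y ∈ (h.domChart.extend I).source := by rwa [h.domChart.extend_source]
    have hwritten := h.writtenInCharts ((h.domChart.extend I).map_source hy')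
    simp only [Function.comp_apply, (h.domChart.extend I).left_inv hy'] at hwritten
    rw [Function.comp_apply, Function.comp_apply, hwritten]
    simp [proj]
  have hdom := mfderiv_extend_injective hn h.domChart_mem_maximalAtlas h.mem_domChart_source
  rw [← hleft.mfderiv_eq, mfderiv_comp x hcod hfx] at hdom
  exact Function.Injective.of_comp hdom

end Immersion

section Slice

section Topology

variable {M X Y : Type*} [TopologicalSpace M] [TopologicalSpace X] [TopologicalSpace Y]

/-- The slice `{ψ₂ = c}` of a chart `ψ = (ψ₁, ψ₂)` with values in a product. -/
def chartSlice (ψ : OpenPartialHomeomorph M (X × Y)) (c : Y) : Set M :=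
  {x ∈ ψ.source | (ψ x).2 = c}

variable (ψ : OpenPartialHomeomorph M (X × Y)) (c : Y)

lemma isOpenEmbedding_fst_chartSlice :
    IsOpenEmbedding fun p : chartSlice ψ c ↦ (ψ p).1 := by
  have hprod (p : chartSlice ψ c) : ((ψ p).1, c) = ψ p := Prod.ext rfl p.2.2.symm
  refine ⟨.of_comp ?_ (Continuous.prodMk_left c) ?_, ?_⟩
  · exact continuous_fst.comp
      (ψ.continuousOn.comp_continuous continuous_subtype_val fun p ↦ p.2.1)
  · have hcomp : (fun x : X ↦ (x, c)) ∘ (fun p : chartSlice ψ c ↦ (ψ p).1) =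
        ψ.source.domRestrict ψ ∘ Set.inclusion fun _ h ↦ h.1 := funext hprod
    rw [hcomp]
    exact ψ.isOpenEmbedding_restrict.isEmbedding.comp (.inclusion _)
  · have hrange : Set.range (fun p : chartSlice ψ c ↦ (ψ p).1) = (·, c) ⁻¹' ψ.target := by
      refine Set.Subset.antisymm (Set.range_subset_iff.2 fun p ↦ ?_) fun x hx ↦ ?_
      · exact (hprod p).symm ▸ ψ.map_source p.2.1
      · exact ⟨⟨ψ.symm (x, c), ψ.map_target hx, by rw [ψ.right_inv hx]⟩, by simp [ψ.right_inv hx]⟩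
    rw [hrange]
    exact ψ.open_target.preimage (Continuous.prodMk_left c)

end Topology

variable {𝕜 : Type*} [NontriviallyNormedField 𝕜]
  {E : Type*} [NormedAddCommGroup E] [NormedSpace 𝕜 E]
  {M : Type*} [TopologicalSpace M] [ChartedSpace E M] {n : ℕ∞ω} [IsManifold 𝓘(𝕜, E) n M]
  {φ : OpenPartialHomeomorph M E}

lemma transHomeomorph_mem_maximalAtlas (hφ : φ ∈ IsManifold.maximalAtlas 𝓘(𝕜, E) n M)
    {T : E ≃ₜ E} (hT : ContDiff 𝕜 n T) (hT' : ContDiff 𝕜 n T.symm) :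
    φ.transHomeomorph T ∈ IsManifold.maximalAtlas 𝓘(𝕜, E) n M :=
  (φ.transHomeomorph T).mem_maximalAtlas_of_contMDiffOn
    (hT.contMDiff.comp_contMDiffOn (contMDiffOn_of_mem_maximalAtlas hφ))
    ((contMDiffOn_symm_of_mem_maximalAtlas hφ).comp hT'.contMDiff.contMDiffOn fun _ h ↦ h)

variable {F G : Type*} [NormedAddCommGroup F] [NormedSpace 𝕜 F] [NormedAddCommGroup G]
  [NormedSpace 𝕜 G]

lemma isImmersionOfComplement_subtypeVal_chartSlice (Φ : E ≃L[𝕜] F × G)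
    (hφ : φ ∈ IsManifold.maximalAtlas 𝓘(𝕜, E) n M) (c : G)
    [ChartedSpace F (chartSlice (φ.transHomeomorph Φ.toHomeomorph) c)]
    {s : OpenPartialHomeomorph (chartSlice (φ.transHomeomorph Φ.toHomeomorph) c) F}
    (hs : s ∈ IsManifold.maximalAtlas 𝓘(𝕜, F) n (chartSlice (φ.transHomeomorph Φ.toHomeomorph) c))
    (hsource : s.source = Set.univ) (hsφ : ∀ p, s p = (Φ (φ p)).1) :
    Manifold.IsImmersionOfComplement G 𝓘(𝕜, F) 𝓘(𝕜, E) n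
      (Subtype.val : chartSlice (φ.transHomeomorph Φ.toHomeomorph) c → M) := by
  intro p
  -- In the chart `φ` the inclusion is affine; translating `φ` makes it linear.
  refine Manifold.IsImmersionAtOfComplement.mk_of_continuousAt continuousAt_subtype_val Φ.symm s
    (φ.transHomeomorph (Homeomorph.addRight (-Φ.symm (0, c)))) (hsource ▸ Set.mem_univ p) p.2.1 hs
    (transHomeomorph_mem_maximalAtlas hφ (contDiff_id.add contDiff_const) (by
      simpa [Homeomorph.addRight_symm] using contDiff_id.add contDiff_const)) fun y hy ↦ ?_
  have hy' : s (s.symm y) = y := s.right_inv (by simpa using hy)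
  have hprod : Φ (φ (s.symm y)) = (y, c) :=
    Prod.ext ((hsφ _).symm.trans hy') (s.symm y).2.2
  have h : φ (s.symm y) - Φ.symm (0, c) = Φ.symm (y, 0) := by
    rw [← Φ.symm_apply_apply (φ (s.symm y)), hprod, ← map_sub]
    simp
  simpa [sub_eq_add_neg] using h

lemma exists_isSmoothEmbedding_chartSlice (Φ : E ≃L[𝕜] F × G)
    (hφ : φ ∈ IsManifold.maximalAtlas 𝓘(𝕜, E) n M) (c : G) :
    ∃ (_ : ChartedSpace F (chartSlice (φ.transHomeomorph Φ.toHomeomorph) c))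
      (_ : IsManifold 𝓘(𝕜, F) n (chartSlice (φ.transHomeomorph Φ.toHomeomorph) c)),
      Manifold.IsSmoothEmbedding 𝓘(𝕜, F) 𝓘(𝕜, E) n
        (Subtype.val : chartSlice (φ.transHomeomorph Φ.toHomeomorph) c → M) := by
  set S := chartSlice (φ.transHomeomorph Φ.toHomeomorph) c
  rcases isEmpty_or_nonempty S with hS | hS
  · let := ChartedSpace.empty F S
    exact ⟨inferInstance, inferInstance, Manifold.IsImmersionOfComplement.isImmersion (F := G)
      fun p ↦ isEmptyElim p, .subtypeVal⟩
  have hemb : IsOpenEmbedding fun p : S ↦ (Φ (φ p)).1 :=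
    isOpenEmbedding_fst_chartSlice (φ.transHomeomorph Φ.toHomeomorph) c
  let := hemb.singletonChartedSpace
  have := hemb.isManifold_singleton (I := 𝓘(𝕜, F)) (n := n)
  exact ⟨_, this, (isImmersionOfComplement_subtypeVal_chartSlice Φ hφ c
    (IsManifold.subset_maximalAtlas (Set.mem_singleton _)) rfl fun _ ↦ rfl).isImmersion,
    .subtypeVal⟩

/-- The splitting of `ℝᵐ⁺²` into its last `m` and its first two coordinates. -/
noncomputable def headTwoEquiv (m : ℕ) :
    EuclideanSpace ℝ (Fin (m + 2)) ≃L[ℝ] EuclideanSpace ℝ (Fin m) × (ℝ × ℝ) :=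
  let uncons (k : ℕ) : (Fin (k + 1) → ℝ) ≃L[ℝ] ℝ × (Fin k → ℝ) := (Fin.consEquivL ℝ fun _ ↦ ℝ).symm
  (EuclideanSpace.equiv (Fin (m + 2)) ℝ).trans <| (uncons (m + 1)).trans <|
    ((ContinuousLinearEquiv.refl ℝ ℝ).prodCongr (uncons m)).trans <|
    (ContinuousLinearEquiv.prodAssoc ℝ ℝ ℝ (Fin m → ℝ)).symm.trans <|
    (ContinuousLinearEquiv.prodComm ℝ (ℝ × ℝ) (Fin m → ℝ)).trans <|
    (EuclideanSpace.equiv (Fin m) ℝ).symm.prodCongr (.refl ℝ (ℝ × ℝ))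

lemma headTwoEquiv_snd {m : ℕ} (q : EuclideanSpace ℝ (Fin (m + 2))) :
    (headTwoEquiv m q).2 = (q 0, q 1) := rfl

lemma chartSlice_headTwoEquiv {m : ℕ} {M : Type*} [TopologicalSpace M]
    (φ : OpenPartialHomeomorph M (EuclideanSpace ℝ (Fin (m + 2)))) (c d : ℝ) :
    chartSlice (φ.transHomeomorph (headTwoEquiv m).toHomeomorph) (c, d) =
      {x ∈ φ.source | φ x 0 = c ∧ φ x 1 = d} := by
  ext x
  simp [chartSlice, headTwoEquiv_snd]

end Slice

namespace IsAdaptedChart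

variable {m : ℕ} {M : Type*} [TopologicalSpace M]
  [ChartedSpace (EuclideanSpace ℝ (Fin (m + 2))) M] [IsManifold (𝓡 (m + 2)) ∞ M]
  {g : LorentzianMetric (𝓡 (m + 2)) M} {Z : Π x : M, TangentSpace (𝓡 (m + 2)) x}
  {φ : OpenPartialHomeomorph M (EuclideanSpace ℝ (Fin (m + 2)))}

lemma isRiemannianSubmanifold (hφ : IsAdaptedChart g Z φ) (c d : ℝ) :
    g.IsRiemannianSubmanifold m {x ∈ φ.source | φ x 0 = c ∧ φ x 1 = d} := by
  rw [← chartSlice_headTwoEquiv]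
  obtain ⟨hcharted, hman, hemb⟩ :=
    exists_isSmoothEmbedding_chartSlice (headTwoEquiv m) hφ.mem_maximalAtlas (c, d)
  refine ⟨hcharted, hman, hemb, inducedRiemannianMetric (B := g.val) g.contMDiff g.symm
    hemb.contMDiff fun p v hv ↦ ?_, fun p v w ↦ rfl⟩
  have himm := hemb.isImmersion.isImmersionAt p
  have hι := himm.contMDiffAt.mdifferentiableAt (by simp)
  have hinj := mfderiv_injective_of_isImmersionAt (by simp) himm
  refine hφ.val_self_pos p.2.1 ((map_ne_zero_iff _ hinj).2 hv) ?_ ?_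
  · exact mvfderiv_mfderiv_eq_zero_of_comp_eq_const (mdifferentiableAt_coord hφ.mem_maximalAtlas
      p.2.1 0) hι (fun q ↦ congrArg Prod.fst q.2.2) v
  · exact mvfderiv_mfderiv_eq_zero_of_comp_eq_const (mdifferentiableAt_coord hφ.mem_maximalAtlas
      p.2.1 1) hι (fun q ↦ congrArg Prod.snd q.2.2) v

end IsAdaptedChart

theorem proposition3p2 {m : ℕ} {M : Type*} [TopologicalSpace M]
    [ChartedSpace (EuclideanSpace ℝ (Fin (m + 2))) M] [IsManifold (𝓡 (m + 2)) ∞ M]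
    (g : LorentzianMetric (𝓡 (m + 2)) M)
    (Z : Π x : M, TangentSpace (𝓡 (m + 2)) x)
    (hZ_smooth : ContMDiff (𝓡 (m + 2)) (𝓡 (m + 2)).tangent ∞
      (fun x ↦ (⟨x, Z x⟩ : TangentBundle (𝓡 (m + 2)) M)))
    (hZ_parallel : ∀ x, g.leviCivita Z x = 0)
    (hZ_null : ∀ x, g.val x (Z x) (Z x) = 0)
    (hZ_nontrivial : ∃ x, Z x ≠ 0)
    (φ : OpenPartialHomeomorph M (EuclideanSpace ℝ (Fin (m + 2))))
    (hφ : IsAdaptedChart g Z φ) :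
    (∀ x ∈ φ.source, ∀ σ ρ : Fin (m + 2),
      HasLineDerivAt ℝ (fun y ↦ g.component φ σ ρ (φ.symm y)) 0 (φ x)
        (EuclideanSpace.single 1 (1 : ℝ))) ∧
    (∀ x ∈ φ.source, ∀ σ : Fin (m + 2), g.component φ 1 σ x = if σ = 0 then 1 else 0) ∧
    (∀ x ∈ φ.source,
      (Matrix.of fun a b : Fin m ↦ g.component φ a.succ.succ b.succ.succ x).PosDef) ∧
    (∀ c d : ℝ, g.IsRiemannianSubmanifold m {x ∈ φ.source | φ x 0 = c ∧ φ x 1 = d}) := by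
  exact ⟨fun x hx σ ρ ↦ hφ.hasLineDerivAt_component hx (hZ_parallel x) σ ρ,
    fun _ hx σ ↦ hφ.component_one hx σ,
    fun _ hx ↦ hφ.posDef_component hx,
    fun c d ↦ hφ.isRiemannianSubmanifold c d⟩
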